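/- A partition of a non-negative integer is a finite non-increasing sequence of positive integers (its parts) with that sum; the empty sequence is the only partition of $0$. A bipartition of $n$ with odd parts distinct is an ordered pair $(\pi_1,\pi_2)$ of partitions, the sum of all parts of $\pi_1$ and $\pi_2$ being $n$, such that no odd integer occurs more than once as a part of $\pi_1$ and no odd integer occurs more than once as a part of $\pi_2$ ($\pi_1$ and $\pi_2$ may share parts, and either may be empty). Let $pod_{-2}(n)$ denote the number of bipartitions of $n$ with odd parts distinct. Theorem. For all integers $\alpha\ge 1$ and $n\ge 0$, the numbers $\frac{11\cdot 5^{\alpha}+1}{4}$ and $\frac{19\cdot 5^{\alpha}+1}{4}$ are integers, and $$pod_{-2}\left(5^{\alpha+1}n+\frac{11\cdot 5^{\alpha}+1}{4}\right)\equiv 0 \pmod 5$$ and $$pod_{-2}\left(5^{\alpha+1}n+\frac{19\cdot 5^{\alpha}+1}{4}\right)\equiv 0 \pmod 5.$$ -/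

import Mathlib

/-- The odd parts of the partition `p` are distinct: no odd part occurs more than once. -/
def OddPartsDistinct {n : ℕ} (p : n.Partition) : Prop :=
  ∀ i ∈ p.parts, Odd i → p.parts.count i = 1

instance {n : ℕ} : DecidablePred (OddPartsDistinct (n := n)) := fun p =>
  inferInstanceAs (Decidable (∀ i ∈ p.parts, Odd i → p.parts.count i = 1))

/-- The bipartitions of `n` with odd parts distinct: ordered pairs `(π₁, π₂)` of partitions
with `|π₁| + |π₂| = n` (either may be empty), such that the odd parts of `π₁` are distinct and
the odd parts of `π₂` are distinct; `π₁` and `π₂` may have parts in common. -/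
abbrev OddDistinctBipartition (n : ℕ) : Type :=
  Σ k : Finset.HasAntidiagonal.antidiagonal n,
    {π₁ : k.1.1.Partition // OddPartsDistinct π₁} × {π₂ : k.1.2.Partition // OddPartsDistinct π₂}

/-- `podNegTwo n` is the number of bipartitions of `n` with odd parts distinct. -/
def podNegTwo (n : ℕ) : ℕ :=
  Fintype.card (OddDistinctBipartition n)

/-! Let ψ(q) = ∑ q^(2k²+k) over k ∈ ℤ (`theta R 1`) and let P be the generating function of
partitions with odd parts distinct. Gauss's identity gives P(-q) = 1/ψ(q), and the signs do not
affect divisibility by 5. Modulo 5, P(-q)² = ψ³/ψ⁵ = ψ(q)³/ψ(q⁵). By exponent modulo 5, ψ = A + B +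
C with residues 0, 1, 3 and C = q³ψ(q²⁵). The terms of ψ³ with exponent ≡ 4 are 6ABC + C³ ≡ (AB +
C²)C, and AB + C² = qψ(q⁵)² (`theta_resInd_mul_add_sq`). Hence ∑ a(5n+4)qⁿ = ψ(q)ψ(q⁵), where a(n)
are the coefficients of P(-q)² (`section5_podSeries`). Since ψ has no exponents ≡ 2, 4, a vanishes
at 25n+14 and 25n+24: the case α = 1. Since the part of ψ with exponents ≡ 3 is C, taking the terms
5n+3 fixes ψ(q)ψ(q⁵), which gives the induction on α. -/

open PowerSeries Filter Topology
open scoped PowerSeries.WithPiTopology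

/-! ### Shanks' finite identity. -/

section Gauss
open Finset
variable {R : Type*} [CommRing R]

/-- `∏_{i < n} (1 - x^(2i+1))`. -/
def oddProd (x : R) (n : ℕ) : R := ∏ i ∈ range n, (1 - x ^ (2 * i + 1))

/-- `∑_{s < n} x^(s(2n+1)) ∏_{s ≤ i < n} (1 - x^(2i+2)) ∏_{i < s} (1 - x^(2i+1))`. -/
def shanksSum (x : R) (n : ℕ) : R :=
  ∑ s ∈ range n, (∏ i ∈ Ico s n, (1 - x ^ (2 * i + 2))) * oddProd x s * x ^ (s * (2 * n + 1))

theorem shanks_telescope (x : R) (n m : ℕ) (h : m ≤ n) :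
    ∑ s ∈ range m, (∏ i ∈ Ico s n, (1 - x ^ (2 * i + 2))) * oddProd x s * x ^ (s * (2 * n + 1)) *
      ((1 - x ^ (2 * n + 2)) * x ^ (2 * s) - (1 - x ^ (2 * n + 1))) =
    (∏ i ∈ Ico m n, (1 - x ^ (2 * i + 2))) * (1 - x ^ (2 * m)) * oddProd x m *
      x ^ (m * (2 * n + 1)) := by
  induction m with
  | zero => simp
  | succ m ih =>
    rw [sum_range_succ, ih (by omega), prod_eq_prod_Ico_succ_bot (by omega : m < n)]
    simp only [oddProd, prod_range_succ]
    ring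

/-- Passing from n to n + 1 multiplies the summand s by (1 - x^(2n+2)) x^(2s); the telescoping sum
measures how far this is from the factor 1 - x^(2n+1). -/
theorem shanksSum_succ (x : R) (n : ℕ) :
    shanksSum x (n + 1) = (1 - x ^ (2 * n + 1)) * shanksSum x n +
      oddProd x (n + 1) * (x ^ (n * (2 * n + 1)) + x ^ ((n + 1) * (2 * n + 1))) := by
  have h := shanks_telescope x n n le_rfl
  have h1 : shanksSum x (n + 1) = ∑ s ∈ range n, (∏ i ∈ Ico s n, (1 - x ^ (2 * i + 2))) *
      oddProd x s * x ^ (s * (2 * n + 1)) * ((1 - x ^ (2 * n + 2)) * x ^ (2 * s)) +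
      (1 - x ^ (2 * n + 2)) * oddProd x n * x ^ (n * (2 * n + 3)) := by
    rw [shanksSum, sum_range_succ]
    congr 1
    · refine sum_congr rfl fun s hs => ?_
      rw [prod_Ico_succ_top (mem_range.mp hs).le]
      ring
    · rw [Nat.Ico_succ_singleton, prod_singleton]
      ring
  have h2 (a u : ℕ → R) (c : R) :
      ∑ s ∈ range n, a s * (u s - c) = ∑ s ∈ range n, a s * u s - (∑ s ∈ range n, a s) * c := by
    rw [sum_mul, ← sum_sub_distrib]
    exact sum_congr rfl fun s _ => mul_sub _ _ _
  rw [h2] at h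
  simp only [Ico_self, prod_empty, one_mul] at h
  rw [h1, show oddProd x (n + 1) = oddProd x n * (1 - x ^ (2 * n + 1)) from prod_range_succ ..]
  rw [shanksSum]
  linear_combination h

/-- Shanks' finite form of Gauss's identity for triangular numbers. -/
theorem sum_triangular_mul_oddProd (x : R) (n : ℕ) :
    (∑ m ∈ range n, (x ^ (m * (2 * m + 1)) + x ^ ((m + 1) * (2 * m + 1)))) * oddProd x n =
      shanksSum x n := by
  induction n with
  | zero => simp [shanksSum]
  | succ n ih =>
    rw [shanksSum_succ, ← ih, sum_range_succ,
      show oddProd x (n + 1) = oddProd x n * (1 - x ^ (2 * n + 1)) from prod_range_succ ..]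
    ring

end Gauss

/-! ### The theta series ψ and Gauss's identity. -/

section Theta

variable {R : Type*} [CommRing R] [TopologicalSpace R]

/-- The exponents `2k² + k`, running over the triangular numbers as `k` runs over `ℤ`. -/
def triExp (k : ℤ) : ℕ := (2 * k ^ 2 + k).toNat

theorem triExp_cast (k : ℤ) : (triExp k : ℤ) = 2 * k ^ 2 + k :=
  Int.toNat_of_nonneg (by nlinarith [Int.le_self_sq (-k), sq_nonneg k])

theorem abs_le_triExp (k : ℤ) : |k| ≤ triExp k := by
  rw [triExp_cast, abs_le]
  constructor <;> nlinarith [Int.le_self_sq (-k), sq_nonneg k]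

theorem finite_triExp_add_triExp (d : ℕ) :
    {p : ℤ × ℤ | triExp p.1 + triExp p.2 = d}.Finite := by
  refine ((Set.finite_Icc (-d : ℤ) d).prod (Set.finite_Icc (-d : ℤ) d)).subset ?_
  rintro ⟨a, b⟩ (h : triExp a + triExp b = d)
  have ha := abs_le.mp (abs_le_triExp a)
  have hb := abs_le.mp (abs_le_triExp b)
  simp only [Set.mem_prod, Set.mem_Icc]
  omega

theorem finite_triExp (d : ℕ) : {k : ℤ | triExp k = d}.Finite := by
  refine (Set.finite_Icc (-d : ℤ) d).subset ?_
  rintro a (h : triExp a = d)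
  have ha := abs_le.mp (abs_le_triExp a)
  simp only [Set.mem_Icc]
  omega

theorem summable_smul_X_pow {ι : Type*} (c : ι → R) (e : ι → ℕ)
    (he : ∀ d, {i | e i = d}.Finite) : Summable fun i => c i • (X : R⟦X⟧) ^ e i := by
  refine (WithPiTopology.summable_iff_summable_coeff _).mpr fun d => ?_
  refine summable_of_hasFiniteSupport ((he d).subset fun i hi => ?_)
  by_contra h
  exact hi (by simp [coeff_X_pow, Ne.symm h])

variable (R) in
/-- The part of `∑ X^(2k²+k)` weighted by `c`. -/
noncomputable def theta (c : ℤ → R) : R⟦X⟧ := ∑' k, c k • (X : R⟦X⟧) ^ triExp k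

theorem hasSum_theta (c : ℤ → R) :
    HasSum (fun k => c k • (X : R⟦X⟧) ^ triExp k) (theta R c) :=
  (summable_smul_X_pow c triExp finite_triExp).hasSum

variable [T3Space R] [IsTopologicalRing R]

theorem hasSum_theta_mul (c d : ℤ → R) :
    HasSum (fun p : ℤ × ℤ => (c p.1 * d p.2) • (X : R⟦X⟧) ^ (triExp p.1 + triExp p.2))
      (theta R c * theta R d) := by
  have : T3Space R⟦X⟧ := inferInstanceAs (T3Space ((Unit →₀ ℕ) → R))
  have key (p : ℤ × ℤ) : (c p.1 * d p.2) • (X : R⟦X⟧) ^ (triExp p.1 + triExp p.2) =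
      c p.1 • (X : R⟦X⟧) ^ triExp p.1 * d p.2 • (X : R⟦X⟧) ^ triExp p.2 := by
    rw [smul_mul_smul_comm, pow_add]
  obtain ⟨u, hu⟩ := summable_smul_X_pow (R := R) (fun p : ℤ × ℤ => c p.1 * d p.2)
    (fun p => triExp p.1 + triExp p.2) finite_triExp_add_triExp
  have hc := hasSum_theta c
  have hd := hasSum_theta d
  simp only [key] at hu ⊢
  generalize theta R c = s at *
  generalize theta R d = t at *
  have hst : s * t = u := HasSum.mul_eq (α := R⟦X⟧) hc hd hu
  rw [hst]
  exact hu

omit [T3Space R] [IsTopologicalRing R] in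
theorem multipliable_one_sub_X_pow_comp (e : ℕ → ℕ) (he : ∀ i, i < e i) :
    Multipliable fun i => (1 : R⟦X⟧) - X ^ e i := by
  nontriviality R
  simp_rw [sub_eq_add_neg]
  apply WithPiTopology.multipliable_one_add_of_tendsto_order_atTop_nhds_top
  refine ENat.tendsto_nhds_top_iff_natCast_lt.mpr fun n => eventually_atTop.mpr ⟨n, fun m hm => ?_⟩
  rw [order_neg, order_X_pow]
  exact_mod_cast hm.trans_lt (he m)

/-- **Gauss's identity** `∑ q^(k(k+1)/2) * ∏ (1 - q^(2i+1)) = ∏ (1 - q^(2i+2))`. -/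
theorem theta_one_mul_tprod :
    theta R 1 * ∏' i : ℕ, (1 - X ^ (2 * i + 1)) = ∏' i : ℕ, (1 - (X : R⟦X⟧) ^ (2 * i + 2)) := by
  have h1 := (multipliable_one_sub_X_pow_comp (R := R) (2 * · + 1)
    (fun i => by omega)).hasProd.tendsto_prod_nat
  have h2 := (multipliable_one_sub_X_pow_comp (R := R) (2 * · + 2)
    (fun i => by omega)).hasProd.tendsto_prod_nat
  have h3 := (hasSum_theta (1 : ℤ → R)).nat_add_neg_add_one.tendsto_sum_nat
  refine tendsto_nhds_unique (h3.mul h1) ?_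
  have h4 (m : ℕ) : triExp m = m * (2 * m + 1) := by
    zify; rw [triExp_cast]; ring
  have h5 (m : ℕ) : triExp (-(m + 1)) = (m + 1) * (2 * m + 1) := by
    zify; rw [triExp_cast]; ring
  have h6 (n : ℕ) := sum_triangular_mul_oddProd (X : R⟦X⟧) n
  simp only [oddProd] at h6
  simp only [Pi.one_apply, one_smul, h4, h5, h6]
  rw [WithPiTopology.tendsto_iff_coeff_tendsto] at h2 ⊢
  intro d
  refine (h2 d).congr' ?_
  filter_upwards [eventually_ge_atTop (d + 1)] with n hn
  obtain ⟨n, rfl⟩ : ∃ m, n = m + 1 := ⟨n - 1, by omega⟩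
  -- Only s = 0 matters in the limit: the terms with s ≥ 1 are divisible by X^(2n+1).
  rw [shanksSum, Finset.sum_range_succ', map_add, map_sum, Finset.sum_eq_zero]
  · simp [oddProd]
  · intro s _
    rw [coeff_mul_X_pow', if_neg]
    nlinarith [Nat.zero_le (s * n)]

end Theta

/-! ### Generating function and product formula. -/

section GenFun

/-- The generating function of partitions with odd parts distinct. -/
noncomputable def podSeries (R : Type*) [CommSemiring R] : R⟦X⟧ :=
  Nat.Partition.genFun fun i c => if Odd i → c = 1 then 1 else 0

theorem coeff_podSeries (R : Type*) [CommSemiring R] (n : ℕ) :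
    coeff n (podSeries R) = Fintype.card {p : n.Partition // OddPartsDistinct p} := by
  simp only [podSeries, Nat.Partition.coeff_genFun, Finsupp.prod, Finset.prod_boole,
    Fintype.card_subtype, Finset.card_filter, Nat.cast_sum]
  refine Finset.sum_congr rfl fun p _ => ?_
  have h : (∀ i ∈ (Multiset.toFinsupp p.parts).support, Odd i → Multiset.toFinsupp p.parts i = 1) ↔
      OddPartsDistinct p := by
    simp [OddPartsDistinct]
  by_cases hp : OddPartsDistinct p
  · rw [if_pos hp, if_pos (h.mpr hp), Nat.cast_one]
  · rw [if_neg hp, if_neg (mt h.mp hp), Nat.cast_zero]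

theorem coeff_podSeries_sq (R : Type*) [CommSemiring R] (n : ℕ) :
    coeff n (podSeries R ^ 2) = (podNegTwo n : R) := by
  rw [sq, coeff_mul, podNegTwo, Fintype.card_sigma, Nat.cast_sum, ← Finset.sum_coe_sort]
  refine Finset.sum_congr rfl fun k _ => ?_
  rw [Fintype.card_prod, coeff_podSeries, coeff_podSeries, Nat.cast_mul]

variable {R : Type*} [CommRing R] [TopologicalSpace R] [T2Space R] [IsTopologicalRing R]

omit [T2Space R] in
theorem continuous_rescale (a : R) : Continuous (rescale a : R⟦X⟧ →+* R⟦X⟧) := by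
  refine continuous_iff_continuousAt.mpr fun f => ?_
  refine (WithPiTopology.tendsto_iff_coeff_tendsto _ _ _ _).mpr fun d => ?_
  simp only [coeff_rescale]
  exact ((WithPiTopology.continuous_coeff R d).tendsto f).const_mul _

theorem hasProd_podSeries : HasProd (fun i : ℕ => if Odd (i + 1) then 1 + (X : R⟦X⟧) ^ (i + 1)
    else ∑' j, (X ^ (i + 1)) ^ j) (podSeries R) := by
  convert! Nat.Partition.hasProd_genFun
    (fun i c => if Odd i → c = 1 then (1 : R) else 0) using 1
  ext1 i
  split_ifs with h
  · rw [tsum_eq_single 0 (by intro b hb; simp [h, hb])]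
    simp
  · have hs : Summable fun j => ((X : R⟦X⟧) ^ (i + 1)) ^ j :=
      WithPiTopology.summable_pow_of_constantCoeff_eq_zero (by simp)
    rw [tsum_eq_zero_add' (by simp_rw [pow_succ]; exact hs.mul_right _)]
    simp [h, pow_mul]

omit [T2Space R] [IsTopologicalRing R] in
theorem hasProd_ite_even {f : ℕ → R⟦X⟧} {a : R⟦X⟧} (h : HasProd f a) :
    HasProd (fun i : ℕ => if Odd (i + 1) then f (i / 2) else 1) a := by
  have hi : Function.Injective (2 * · : ℕ → ℕ) := fun a b h => by simpa using h
  rw [← hi.hasProd_iff]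
  · convert h using 1
    funext i
    simp
  · intro i hi
    rw [if_neg]
    rintro ⟨k, hk⟩
    exact hi ⟨k, by simp; omega⟩

omit [T2Space R] [IsTopologicalRing R] in
theorem hasProd_ite_odd {f : ℕ → R⟦X⟧} {a : R⟦X⟧} (h : HasProd f a) :
    HasProd (fun i : ℕ => if Odd (i + 1) then 1 else f (i / 2)) a := by
  have hi : Function.Injective (2 * · + 1 : ℕ → ℕ) := fun a b h => by simpa using h
  rw [← hi.hasProd_iff]
  · convert h using 1
    funext i
    have : ¬ Odd (2 * i + 1 + 1) := by rw [Nat.not_odd_iff_even]; exact ⟨i + 1, by ring⟩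
    simp only [Function.comp, this, if_false]
    congr 1; omega
  · intro i hi
    rw [if_pos]
    by_contra h
    obtain ⟨k, hk⟩ := Nat.not_odd_iff_even.mp h
    exact hi ⟨k - 1, by simp; omega⟩

theorem rescale_podSeries_mul_tprod :
    rescale (-1) (podSeries R) * ∏' i : ℕ, (1 - (X : R⟦X⟧) ^ (2 * i + 2)) =
      ∏' i : ℕ, (1 - X ^ (2 * i + 1)) := by
  have h1 := hasProd_ite_even (multipliable_one_sub_X_pow_comp (R := R) (2 * · + 1)
    (fun i => by omega)).hasProd
  have h2 := hasProd_ite_odd (multipliable_one_sub_X_pow_comp (R := R) (2 * · + 2)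
    (fun i => by omega)).hasProd
  have h3 := (hasProd_podSeries (R := R)).map (rescale (-1 : R)) (continuous_rescale (-1))
  refine (h3.mul h2).unique ?_
  convert h1 using 1
  funext i
  simp only [Function.comp]
  split_ifs with h
  · have : 2 * (i / 2) + 1 = i + 1 := by obtain ⟨k, hk⟩ := h; omega
    rw [this]
    rw [map_add, map_one, map_pow, rescale_neg_one_X, h.neg_pow, mul_one, sub_eq_add_neg]
  · have hi : 2 * (i / 2) + 2 = i + 1 := by
      obtain ⟨k, hk⟩ := Nat.not_odd_iff_even.mp h; omega
    rw [hi]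
    have hx : rescale (-1 : R) (1 - X ^ (i + 1)) = 1 - X ^ (i + 1) := by
      rw [map_sub, map_one, map_pow, rescale_neg_one_X, (Nat.not_odd_iff_even.mp h).neg_pow]
    rw [← hx, ← map_mul, WithPiTopology.tsum_pow_mul_one_sub_of_constantCoeff_eq_zero (by simp),
      map_one]

end GenFun

section
variable {R : Type*} [CommRing R] [TopologicalSpace R] [T3Space R] [IsTopologicalRing R]

theorem rescale_podSeries_mul_theta [IsDomain R] :
    rescale (-1) (podSeries R) * theta R 1 = 1 := by
  have h0 : ∏' i : ℕ, (1 - (X : R⟦X⟧) ^ (2 * i + 1)) ≠ 0 := by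
    intro h
    have := congrArg constantCoeff h
    rw [(multipliable_one_sub_X_pow_comp (R := R) (2 * · + 1) (fun i => by omega)).map_tprod _
      (WithPiTopology.continuous_constantCoeff R)] at this
    simp at this
  apply mul_right_cancel₀ h0
  rw [mul_assoc, theta_one_mul_tprod, rescale_podSeries_mul_tprod, one_mul]
end

/-! ### Splitting power series by exponent modulo 5. -/

section Dissection
variable {R : Type*} [CommRing R]

/-- `F` only involves powers of `X` with exponent `≡ r` modulo `5`. -/
def SupportedMod (r : ℕ) (F : R⟦X⟧) : Prop := ∀ n, coeff n F ≠ 0 → n % 5 = r % 5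

theorem SupportedMod.mul {r s : ℕ} {F G : R⟦X⟧} (hF : SupportedMod r F) (hG : SupportedMod s G) :
    SupportedMod (r + s) (F * G) := by
  intro n hn
  rw [coeff_mul] at hn
  obtain ⟨⟨i, j⟩, hij, h⟩ := Finset.exists_ne_zero_of_sum_ne_zero hn
  have h1 := hF i (left_ne_zero_of_mul h)
  have h2 := hG j (right_ne_zero_of_mul h)
  rw [Finset.HasAntidiagonal.mem_antidiagonal] at hij
  simp only at hij
  omega

/-- `∑ a(5n+r) X^n`, where `F = ∑ a(n) X^n`. -/
noncomputable def section5 (r : ℕ) : R⟦X⟧ →ₗ[R] R⟦X⟧ where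
  toFun F := PowerSeries.mk fun n => coeff (5 * n + r) F
  map_add' F G := by ext; simp
  map_smul' c F := by ext; simp

theorem coeff_section5 (r n : ℕ) (F : R⟦X⟧) : coeff n (section5 r F) = coeff (5 * n + r) F :=
  coeff_mk n fun n => coeff (5 * n + r) F

theorem SupportedMod.section5_eq_zero {r s : ℕ} {F : R⟦X⟧} (hF : SupportedMod r F)
    (h : r % 5 ≠ s % 5) : section5 s F = 0 := by
  ext n
  rw [coeff_section5, map_zero]
  by_contra hn
  have := hF _ hn
  omega

theorem section5_mul_expand {r : ℕ} (hr : r < 5) (F G : R⟦X⟧) :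
    section5 r (F * expand 5 (by norm_num) G) = section5 r F * G := by
  ext n
  rw [coeff_section5, coeff_mul, coeff_mul]
  symm
  refine Finset.sum_of_injOn (fun p => (5 * p.1 + r, 5 * p.2)) ?_ ?_ ?_ ?_
  · rintro ⟨a, b⟩ _ ⟨c, d⟩ _ h
    simp only [Prod.mk.injEq] at h ⊢
    omega
  · rintro ⟨a, b⟩ h
    simp only [Finset.mem_coe, Finset.HasAntidiagonal.mem_antidiagonal] at h ⊢
    omega
  · rintro ⟨a, b⟩ h h'
    rw [coeff_expand_of_not_dvd, mul_zero]
    rintro ⟨c, rfl⟩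
    rw [Finset.HasAntidiagonal.mem_antidiagonal] at h
    simp only at h
    refine h' ⟨(n - c, c), ?_, ?_⟩
    · simp; omega
    · simp; omega
  · rintro ⟨a, b⟩ _
    rw [coeff_section5, coeff_expand_mul]

theorem section5_X_pow_mul_expand {r : ℕ} (hr : r < 5) (G : R⟦X⟧) :
    section5 r (X ^ r * expand 5 (by norm_num) G) = G := by
  rw [section5_mul_expand hr]
  convert one_mul G
  ext n
  rw [coeff_section5, coeff_X_pow, coeff_one]
  congr 1
  simp

theorem expand_five_eq_pow (F : (ZMod 5)⟦X⟧) : expand 5 (by norm_num) F = F ^ 5 := by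
  have : Fact (Nat.Prime 5) := ⟨by norm_num⟩
  have h := MvPowerSeries.map_frobenius_expand 5 (by norm_num)
    (f := (F : MvPowerSeries Unit (ZMod 5)))
  rw [ZMod.frobenius_zmod] at h
  exact h

end Dissection

/-! ### The 5-dissection of ψ. -/

section ThetaDissection
variable {R : Type*} [CommRing R] [TopologicalSpace R] [DiscreteTopology R]

omit [DiscreteTopology R] in
theorem continuous_expand (p : ℕ) (hp : p ≠ 0) : Continuous (expand p hp : R⟦X⟧ → R⟦X⟧) := by
  refine continuous_iff_continuousAt.mpr fun f => ?_
  refine (WithPiTopology.tendsto_iff_coeff_tendsto _ _ _ _).mpr fun d => ?_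
  simp only [coeff_expand]
  split_ifs
  · exact (WithPiTopology.continuous_coeff R _).tendsto f
  · exact tendsto_const_nhds

theorem theta_supportedMod {r : ℕ} {c : ℤ → R} (h : ∀ k, c k ≠ 0 → triExp k % 5 = r % 5) :
    SupportedMod r (theta R c) := by
  intro n hn
  by_contra hr
  apply hn
  have h1 := (hasSum_theta c).map (coeff (R := R) n) (WithPiTopology.continuous_coeff R n)
  refine h1.unique ?_
  convert hasSum_zero with k
  by_cases hk : c k = 0
  · simp [hk]
  · have := h k hk
    have : n ≠ triExp k := by rintro rfl; exact hr this
    simp [coeff_X_pow, this]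

variable (R) in
/-- The indicator of the integers whose residue modulo `5` lies in `s`. -/
def resInd (s : Finset ℤ) (k : ℤ) : R := if k % 5 ∈ s then 1 else 0

theorem triExp_mod (k : ℤ) : ((triExp k % 5 : ℕ) : ℤ) = (2 * (k % 5) ^ 2 + k % 5) % 5 := by
  push_cast
  rw [triExp_cast]
  exact (((Int.mod_modEq k 5).pow 2).mul_left 2 |>.add (Int.mod_modEq k 5)).symm

theorem resInd_supportedMod (s : Finset ℤ) (r : ℕ)
    (h : ∀ a ∈ s, (2 * a ^ 2 + a) % 5 = (r : ℤ) % 5) :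
    SupportedMod r (theta R (resInd R s)) := by
  refine theta_supportedMod fun k hk => ?_
  have hk' : k % 5 ∈ s := by
    by_contra hs
    exact hk (if_neg hs)
  zify
  rw [← h _ hk', ← triExp_mod]
  push_cast
  rfl

theorem theta_one_eq_add : theta R 1 =
    theta R (resInd R {0, 2}) + theta R (resInd R {3, 4}) + theta R (resInd R {1}) := by
  refine (hasSum_theta 1).unique ?_
  convert ((hasSum_theta (resInd R {0, 2})).add (hasSum_theta (resInd R {3, 4}))).add
    (hasSum_theta (resInd R {1})) using 1
  funext k
  rw [← add_smul, ← add_smul]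
  congr 1
  have h1 := Int.emod_nonneg k (by norm_num : (5 : ℤ) ≠ 0)
  have h2 := Int.emod_lt_of_pos k (by norm_num : (0 : ℤ) < 5)
  simp only [resInd, Finset.mem_insert, Finset.mem_singleton, Pi.one_apply]
  generalize k % 5 = m at *
  interval_cases m <;> simp

/-- Substituting k = 5j + 1 turns 2k² + k into 3 + 25(2j² + j). -/
theorem theta_resInd_one : theta R (resInd R {1}) =
    X ^ 3 * expand 5 (by norm_num) (expand 5 (by norm_num) (theta R 1)) := by
  have h5 : (5 : ℕ) ≠ 0 := by norm_num
  have h := (((hasSum_theta (1 : ℤ → R)).map (expand 5 h5) (continuous_expand 5 h5)).map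
    (expand 5 h5) (continuous_expand 5 h5)).mul_left (X ^ 3)
  have hi : Function.Injective (fun k : ℤ => 5 * k + 1) := fun a b h => by
    simp only at h; omega
  refine (hi.hasSum_iff ?_).mpr (hasSum_theta (resInd R {1})) |>.unique ?_
  · intro k hk
    have : k % 5 ≠ 1 := fun h => hk ⟨k / 5, by simp only; omega⟩
    simp [resInd, this]
  · refine Eq.mp (congrArg (HasSum · _) ?_) h
    funext k
    have e : triExp (5 * k + 1) = 3 + 5 * (5 * triExp k) := by
      zify; simp only [triExp_cast]; ring
    have : (5 * k + 1) % 5 = 1 := by omega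
    simp only [Function.comp, resInd, this, e, Finset.mem_singleton, if_true, one_smul,
      Pi.one_apply, map_pow, expand_X, ← pow_mul, ← pow_add]

/-- Multiplication by `2 + i` on Gaussian integers, in the coordinates in which the exponent of the
square of the theta series is a norm form, followed by a swap for half of the residue classes. -/
def gaussMap (p : ℤ × ℤ) : ℤ × ℤ :=
  if (2 * p.1 - p.2) % 5 < 3 then (2 * p.1 - p.2, -p.1 - 2 * p.2 - 1)
  else (-p.1 - 2 * p.2 - 1, 2 * p.1 - p.2)

theorem gaussMap_injective : Function.Injective gaussMap := by
  rintro ⟨a, b⟩ ⟨c, d⟩ h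
  simp only [gaussMap] at h
  split_ifs at h <;> simp only [Prod.mk.injEq] at h ⊢ <;> omega

/-- With x = 4a + 1 and y = 4b + 1, eight times the exponent sum plus 2 is x² + y². The map sends
(x, y) to (2x - y, -(x + 2y)) up to a swap, so this norm is multiplied by 5. -/
theorem triExp_gaussMap (p : ℤ × ℤ) : triExp (gaussMap p).1 + triExp (gaussMap p).2 =
    1 + 5 * (triExp p.1 + triExp p.2) := by
  rw [gaussMap]
  split_ifs <;> zify <;> simp only [triExp_cast] <;> ring

-- Before the swap the image (u, v) satisfies v ≡ 2u + 4 modulo 5. The swap for u ≡ 3, 4 turns (3,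
-- 0), (4, 2) into (0, 3), (2, 4), so the classes hit are exactly those of AB + C².
omit [TopologicalSpace R] [DiscreteTopology R] in
theorem resInd_gaussMap (p : ℤ × ℤ) :
    resInd R {0, 2} (gaussMap p).1 * resInd R {3, 4} (gaussMap p).2 +
      resInd R {1} (gaussMap p).1 * resInd R {1} (gaussMap p).2 = 1 := by
  obtain ⟨a, b⟩ := p
  have h1 := Int.emod_nonneg (2 * a - b) (by norm_num : (5 : ℤ) ≠ 0)
  have h2 := Int.emod_lt_of_pos (2 * a - b) (by norm_num : (0 : ℤ) < 5)
  have h3 : (-a - 2 * b - 1) % 5 = (2 * ((2 * a - b) % 5) + 4) % 5 := by omega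
  simp only [gaussMap, resInd, Finset.mem_insert, Finset.mem_singleton]
  split_ifs with h <;> simp only [h3] at * <;> generalize (2 * a - b) % 5 = m at * <;>
    interval_cases m <;> simp_all

omit [TopologicalSpace R] [DiscreteTopology R] in
theorem mem_range_gaussMap {p : ℤ × ℤ}
    (h : resInd R {0, 2} p.1 * resInd R {3, 4} p.2 + resInd R {1} p.1 * resInd R {1} p.2 ≠ 0) :
    p ∈ Set.range gaussMap := by
  obtain ⟨a, b⟩ := p
  have key : (a % 5 = 0 ∨ a % 5 = 2) ∧ (b % 5 = 3 ∨ b % 5 = 4) ∨ a % 5 = 1 ∧ b % 5 = 1 := by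
    by_contra hk
    apply h
    simp only [resInd, Finset.mem_insert, Finset.mem_singleton]
    split_ifs <;> simp_all
  -- This holds for the classes (0, 4), (2, 3), (1, 1), reached without a swap; the witnesses invert
  -- the linear map.
  by_cases hab : (2 * a - b) % 5 = 1
  · refine ⟨((2 * a - b - 1) / 5, (-a - 2 * b - 2) / 5), ?_⟩
    rw [gaussMap, if_pos (by simp only; omega)]
    ext <;> simp only <;> omega
  · refine ⟨((2 * b - a - 1) / 5, (-b - 2 * a - 2) / 5), ?_⟩
    rw [gaussMap, if_neg (by simp only; omega)]
    ext <;> simp only <;> omega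

theorem theta_resInd_mul_add_sq :
    theta R (resInd R {0, 2}) * theta R (resInd R {3, 4}) + theta R (resInd R {1}) ^ 2 =
      X * expand 5 (by norm_num) (theta R 1 ^ 2) := by
  have h5 : (5 : ℕ) ≠ 0 := by norm_num
  have h1 := (hasSum_theta_mul (resInd R {0, 2}) (resInd R {3, 4})).add
    (hasSum_theta_mul (resInd R {1}) (resInd R {1}))
  have h2 := ((hasSum_theta_mul (1 : ℤ → R) 1).map (expand 5 h5) (continuous_expand 5 h5)).mul_left
    X
  rw [sq, sq]
  simp only [← add_smul] at h1
  refine ((gaussMap_injective.hasSum_iff fun p hp => ?_).mpr h1).unique ?_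
  · rw [not_imp_comm.mp mem_range_gaussMap hp, zero_smul]
  · refine Eq.mp (congrArg (HasSum · _) ?_) h2
    funext p
    simp only [Function.comp, resInd_gaussMap, triExp_gaussMap, one_smul, Pi.one_apply, mul_one]
    rw [map_pow, expand_X, ← pow_mul, pow_add, pow_one]

end ThetaDissection

/-! ### Sections of ψ, ψ³ and P(-q)² modulo 5. -/

section ModFive
variable [TopologicalSpace (ZMod 5)] [DiscreteTopology (ZMod 5)]

theorem section5_theta_pow_three : section5 4 (theta (ZMod 5) 1 ^ 3) =
    theta (ZMod 5) 1 ^ 2 * expand 5 (by norm_num) (theta (ZMod 5) 1) := by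
  have hA : SupportedMod 0 (theta (ZMod 5) (resInd (ZMod 5) {0, 2})) :=
    resInd_supportedMod _ _ (by decide)
  have hB : SupportedMod 1 (theta (ZMod 5) (resInd (ZMod 5) {3, 4})) :=
    resInd_supportedMod _ _ (by decide)
  have hC : SupportedMod 3 (theta (ZMod 5) (resInd (ZMod 5) {1})) :=
    resInd_supportedMod _ _ (by decide)
  have hsum := theta_one_eq_add (R := ZMod 5)
  have hC' := theta_resInd_one (R := ZMod 5)
  have hAB := theta_resInd_mul_add_sq (R := ZMod 5)
  generalize theta (ZMod 5) (resInd (ZMod 5) {0, 2}) = A at *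
  generalize theta (ZMod 5) (resInd (ZMod 5) {3, 4}) = B at *
  generalize theta (ZMod 5) (resInd (ZMod 5) {1}) = C at *
  have h5 : (5 : (ZMod 5)⟦X⟧) = 0 := by
    rw [← map_ofNat (PowerSeries.C (R := ZMod 5)) 5, show (OfNat.ofNat 5 : ZMod 5) = 0 from rfl,
      map_zero]
  -- The coefficient 6 of ABC becomes 1; every monomial in the second group has exponents not ≡ 4.
  have key : (A + B + C) ^ 3 = (A * B + C ^ 2) * C + (A * A * A + (3 : ZMod 5) • (A * A * B) +
      (3 : ZMod 5) • (A * A * C) + (3 : ZMod 5) • (A * B * B) + (3 : ZMod 5) • (A * C * C) +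
      B * B * B + (3 : ZMod 5) • (B * B * C) + (3 : ZMod 5) • (B * C * C)) := by
    simp only [smul_eq_C_mul, map_ofNat]
    linear_combination (A * B * C) * h5
  have hmain : (A * B + C ^ 2) * C = X ^ 4 * expand 5 (by norm_num)
      (theta (ZMod 5) 1 ^ 2 * expand 5 (by norm_num) (theta (ZMod 5) 1)) := by
    rw [hAB, hC', map_mul]
    ring
  rw [hsum, key, map_add, hmain, section5_X_pow_mul_expand (by norm_num), ← hsum]
  simp only [map_add, map_smul,
    ((hA.mul hA).mul hA).section5_eq_zero (s := 4) (by norm_num),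
    ((hA.mul hA).mul hB).section5_eq_zero (s := 4) (by norm_num),
    ((hA.mul hA).mul hC).section5_eq_zero (s := 4) (by norm_num),
    ((hA.mul hB).mul hB).section5_eq_zero (s := 4) (by norm_num),
    ((hA.mul hC).mul hC).section5_eq_zero (s := 4) (by norm_num),
    ((hB.mul hB).mul hB).section5_eq_zero (s := 4) (by norm_num),
    ((hB.mul hB).mul hC).section5_eq_zero (s := 4) (by norm_num),
    ((hB.mul hC).mul hC).section5_eq_zero (s := 4) (by norm_num), smul_zero, add_zero]

theorem section5_theta_eq_zero {r : ℕ} (hr : r = 2 ∨ r = 4) :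
    section5 r (theta (ZMod 5) 1) = 0 := by
  rw [theta_one_eq_add, map_add, map_add,
    (resInd_supportedMod {0, 2} 0 (by decide)).section5_eq_zero (by omega),
    (resInd_supportedMod {3, 4} 1 (by decide)).section5_eq_zero (by omega),
    (resInd_supportedMod {1} 3 (by decide)).section5_eq_zero (by omega)]
  simp

theorem section5_three_theta :
    section5 3 (theta (ZMod 5) 1) = expand 5 (by norm_num) (theta (ZMod 5) 1) := by
  have h := congrArg (section5 3) (theta_one_eq_add (R := ZMod 5))
  rwa [map_add, map_add,
    (resInd_supportedMod {0, 2} 0 (by decide)).section5_eq_zero (by norm_num),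
    (resInd_supportedMod {3, 4} 1 (by decide)).section5_eq_zero (by norm_num),
    theta_resInd_one, section5_X_pow_mul_expand (by norm_num), zero_add, zero_add] at h

theorem section5_podSeries : section5 4 (rescale (-1) (podSeries (ZMod 5)) ^ 2) =
    theta (ZMod 5) 1 * expand 5 (by norm_num) (theta (ZMod 5) 1) := by
  have : Fact (Nat.Prime 5) := ⟨by norm_num⟩
  have h := rescale_podSeries_mul_theta (R := ZMod 5)
  have h0 : theta (ZMod 5) 1 ≠ 0 := right_ne_zero_of_mul_eq_one h
  apply mul_right_cancel₀ h0
  rw [← section5_mul_expand (by norm_num), expand_five_eq_pow]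
  have h1 : rescale (-1) (podSeries (ZMod 5)) ^ 2 * theta (ZMod 5) 1 ^ 5 =
      theta (ZMod 5) 1 ^ 3 := by
    linear_combination (theta (ZMod 5) 1 ^ 3) *
      (rescale (-1) (podSeries (ZMod 5)) * theta (ZMod 5) 1 + 1) * h
  rw [h1, section5_theta_pow_three, expand_five_eq_pow]
  ring

end ModFive

/-! ### The congruences and the induction on α. -/

theorem section5_section5_podSeries {r : ℕ} (hr : r = 2 ∨ r = 4) :
    section5 r (section5 4 (rescale (-1) (podSeries (ZMod 5)) ^ 2)) = 0 := by
  let _ : TopologicalSpace (ZMod 5) := ⊥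
  have : DiscreteTopology (ZMod 5) := ⟨rfl⟩
  rw [section5_podSeries, section5_mul_expand (by omega), section5_theta_eq_zero hr, zero_mul]

theorem section5_three_section5_podSeries :
    section5 3 (section5 4 (rescale (-1) (podSeries (ZMod 5)) ^ 2)) =
      section5 4 (rescale (-1) (podSeries (ZMod 5)) ^ 2) := by
  let _ : TopologicalSpace (ZMod 5) := ⊥
  have : DiscreteTopology (ZMod 5) := ⟨rfl⟩
  rw [section5_podSeries, section5_mul_expand (by omega), section5_three_theta, mul_comm]

theorem podNegTwo_modEq_zero_iff (n : ℕ) :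
    podNegTwo n ≡ 0 [MOD 5] ↔ coeff n (rescale (-1) (podSeries (ZMod 5)) ^ 2) = 0 := by
  rw [← map_pow, coeff_rescale, coeff_podSeries_sq, ← ZMod.natCast_eq_natCast_iff, Nat.cast_zero,
    IsUnit.mul_right_eq_zero ((isUnit_one.neg).pow n)]

theorem podNegTwo_modEq_zero_of_base {r : ℕ} (hr : r = 2 ∨ r = 4) (n : ℕ) :
    podNegTwo (5 * (5 * n + r) + 4) ≡ 0 [MOD 5] := by
  rw [podNegTwo_modEq_zero_iff, ← coeff_section5, ← coeff_section5,
    section5_section5_podSeries hr, map_zero]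

theorem podNegTwo_modEq_zero_step {m : ℕ} (h : podNegTwo (5 * m + 4) ≡ 0 [MOD 5]) :
    podNegTwo (5 * (5 * m + 3) + 4) ≡ 0 [MOD 5] := by
  rw [podNegTwo_modEq_zero_iff, ← coeff_section5] at h ⊢
  rwa [← coeff_section5, section5_three_section5_podSeries]

/-- The induction step replaces M = 5m + 4 by 5M - 1 = 25m + 19, which takes 4M = 4·5^(α+1)n + c·5^α
+ 1 to the same relation for α + 1. -/
theorem podNegTwo_modEq_zero_of_four_mul {α N c n : ℕ} (hα : 1 ≤ α) (hc : c = 11 ∨ c = 19)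
    (hN : 4 * N = 4 * (5 ^ (α + 1) * n) + (c * 5 ^ α + 1)) : podNegTwo N ≡ 0 [MOD 5] := by
  induction α, hα using Nat.le_induction generalizing N with
  | base =>
    rcases hc with rfl | rfl
    · rw [show N = 5 * (5 * n + 2) + 4 by omega]
      exact podNegTwo_modEq_zero_of_base (.inl rfl) n
    · rw [show N = 5 * (5 * n + 4) + 4 by omega]
      exact podNegTwo_modEq_zero_of_base (.inr rfl) n
  | succ k hk ih =>
    obtain ⟨j, rfl⟩ : ∃ j, k = j + 1 := ⟨k - 1, by omega⟩
    have e1 : 5 ^ (j + 1 + 1) * n = 25 * (5 ^ j * n) := by ring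
    have e2 : 5 ^ (j + 1 + 1 + 1) * n = 125 * (5 ^ j * n) := by ring
    have e3 : 5 ^ (j + 1) = 5 * 5 ^ j := by ring
    have e4 : 5 ^ (j + 1 + 1) = 25 * 5 ^ j := by ring
    rw [e2, e4] at hN
    rw [e1, e3] at ih
    obtain ⟨m, hm⟩ : ∃ m, N = 5 * (5 * m + 3) + 4 := by
      refine ⟨(N - 19) / 25, ?_⟩
      have : 1 ≤ 5 ^ j := Nat.one_le_pow _ _ (by norm_num)
      rcases hc with rfl | rfl <;> omega
    rw [hm]
    refine podNegTwo_modEq_zero_step (ih ?_)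
    rcases hc with rfl | rfl <;> omega

theorem mainTheorem2 (α n : ℕ) (hα : 1 ≤ α) :
    4 ∣ 11 * 5 ^ α + 1 ∧ 4 ∣ 19 * 5 ^ α + 1 ∧
    podNegTwo (5 ^ (α + 1) * n + (11 * 5 ^ α + 1) / 4) ≡ 0 [MOD 5] ∧
    podNegTwo (5 ^ (α + 1) * n + (19 * 5 ^ α + 1) / 4) ≡ 0 [MOD 5] := by
  have h5 : 5 ^ α % 4 = 1 := by rw [Nat.pow_mod]; simp
  refine ⟨by omega, by omega, ?_, ?_⟩
  · exact podNegTwo_modEq_zero_of_four_mul (c := 11) (n := n) hα (.inl rfl) (by omega)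
  · exact podNegTwo_modEq_zero_of_four_mul (c := 19) (n := n) hα (.inr rfl) (by omega)
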